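/- Let $X$ be a first countable topological space, let $x=(x_n)_{n\in\mathbf N}$ be a sequence in $X$, and let $\mathcal I$ be an analytic P-ideal on $\mathbf N$: that is, $\mathcal I\subseteq\mathcal P(\mathbf N)$ is closed under subsets and finite unions, contains all finite sets, does not contain $\mathbf N$, is an analytic subset of $\mathcal P(\mathbf N)$ (identified with the Cantor space $\{0,1\}^{\mathbf N}$), and for all $A_0,A_1,\dots\in\mathcal I$ there is $A\in\mathcal I$ such that every $A_n\setminus A$ is finite. Let $\Lambda_x(\mathcal I)$ be the set of all $\ell\in X$ such that some subsequence $(x_{n_k})_k$ with $\{n_k:k\in\mathbf N\}\notin\mathcal I$ converges to $\ell$. A lower semicontinuous submeasure is a map $\varphi:\mathcal P(\mathbf N)\to[0,\infty]$ with $\varphi(\emptyset)=0$, $\varphi(A)\le\varphi(B)$ for $A\subseteq B$, $\varphi(A\cup B)\le\varphi(A)+\varphi(B)$, and $\varphi(A)=\lim_n\varphi(A\cap[n])$ for all $A,B\subseteq\mathbf N$, where $[n]$ is the set of the first $n$ elements of $\mathbf N$. Put $\|A\|_\varphi:=\lim_n\varphi(A\setminus[n])$ and $\mathcal I_\varphi:=\{A\subseteq\mathbf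 N:\|A\|_\varphi=0\}$. Then: 1. There is a lower semicontinuous submeasure $\varphi$ with $\varphi(\mathbf N)<\infty$ and $\mathcal I=\mathcal I_\varphi$. 2. Let $\varphi$ be any lower semicontinuous submeasure with $\mathcal I=\mathcal I_\varphi$. For every $\ell\in X$ and every decreasing local base $(U_k)$ of neighborhoods at $\ell$, the limit $$\mathfrak u(\ell):=\lim_{k\to\infty}\|\{n\in\mathbf N:x_n\in U_k\}\|_\varphi$$ exists in $[0,\infty]$ and does not depend on the choice of $(U_k)$; the map $\mathfrak u:X\to[0,\infty]$ is upper semicontinuous; and $$\Lambda_x(\mathcal I)=\{\ell\in X:\mathfrak u(\ell)>0\}.$$ 3. $\Lambda_x(\mathcal I)$ is an $F_\sigma$-set, that is, a countable union of closed subsets of $X$. -/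

import Mathlib

open Set Filter Topology
open scoped ENNReal

/-- A (proper) ideal on the natural numbers which contains every finite set. -/
structure IsAdmissibleIdeal (I : Order.Ideal (Set ℕ)) : Prop where
  proper : (univ : Set ℕ) ∉ I
  finite_mem : ∀ F : Set ℕ, F.Finite → F ∈ I

/-- `I` is σ-directed modulo finite sets. -/
def IsPIdeal (I : Order.Ideal (Set ℕ)) : Prop :=
  ∀ A : ℕ → Set ℕ, (∀ n, A n ∈ I) → ∃ B ∈ I, ∀ n, (A n \ B).Finite

/-- `I` is an analytic subset of the Cantor space `ℕ → Bool`, a set of natural numbers being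
identified with its characteristic function. -/
def IsAnalyticIdeal (I : Order.Ideal (Set ℕ)) : Prop :=
  MeasureTheory.AnalyticSet {c : ℕ → Bool | {n | c n = true} ∈ I}

/-- Analytic P-ideals on the natural numbers. -/
structure IsAnalyticPIdeal (I : Order.Ideal (Set ℕ)) : Prop where
  admissible : IsAdmissibleIdeal I
  analytic : IsAnalyticIdeal I
  pIdeal : IsPIdeal I

/-- Lower semicontinuous submeasures. Here `Iio n = {0, …, n - 1}` consists of the first `n`
natural numbers. -/
structure IsLSCSubmeasure (φ : Set ℕ → ℝ≥0∞) : Prop where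
  empty : φ ∅ = 0
  mono : ∀ A B : Set ℕ, A ⊆ B → φ A ≤ φ B
  union_le : ∀ A B : Set ℕ, φ (A ∪ B) ≤ φ A + φ B
  lsc : ∀ A : Set ℕ, Tendsto (fun n : ℕ => φ (A ∩ Iio n)) atTop (𝓝 (φ A))

/-- `‖A‖_φ`, the limit of the decreasing sequence `φ (A \ {0, …, n - 1})`;
see `IsLSCSubmeasure.tendsto_exhNorm`. -/
noncomputable def exhNorm (φ : Set ℕ → ℝ≥0∞) (A : Set ℕ) : ℝ≥0∞ :=
  ⨅ n : ℕ, φ (A \ Iio n)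

theorem IsLSCSubmeasure.tendsto_exhNorm {φ : Set ℕ → ℝ≥0∞} (hφ : IsLSCSubmeasure φ)
    (A : Set ℕ) : Tendsto (fun n : ℕ => φ (A \ Iio n)) atTop (𝓝 (exhNorm φ A)) :=
  tendsto_atTop_iInf fun _ _ h =>
    hφ.mono _ _ (sdiff_subset_sdiff_right (Iio_subset_Iio h))

/-- The family `I_φ` of all sets `A` with `‖A‖_φ = 0`. -/
def exhFamily (φ : Set ℕ → ℝ≥0∞) : Set (Set ℕ) := {A | exhNorm φ A = 0}

/-- The set of `I`-limit points of the sequence `x`: the limits of those subsequences of `x`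
whose set of indices is not in `I`. -/
def idealLimitPoints {X : Type*} [TopologicalSpace X] (I : Order.Ideal (Set ℕ)) (x : ℕ → X) :
    Set X :=
  {ℓ | ∃ s : ℕ → ℕ, StrictMono s ∧ range s ∉ I ∧ Tendsto (fun k => x (s k)) atTop (𝓝 ℓ)}

/-- Countable unions of closed sets. -/
def IsFSigma {X : Type*} [TopologicalSpace X] (S : Set X) : Prop :=
  ∃ C : ℕ → Set X, (∀ n, IsClosed (C n)) ∧ S = ⋃ n, C n

/-! The mass 𝔲(ℓ) is an infimum over neighborhoods, hence upper semicontinuous, and {𝔲 > 0} is the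
union of the closed sets {𝔲 ≥ 1/n}. If 𝔲(ℓ) > 0, lower semicontinuity of φ allows finite blocks of
the sets {n : x_n ∈ U_k} to be glued into one index set of positive norm
(`IsLSCSubmeasure.exists_subset_of_lt_exhNorm`); it enumerates a subsequence tending to ℓ.

The existence of φ is Solecki's theorem. Let I be the range of a continuous F on Baire space. As I
is a P-ideal, the sets V for which F '' V is not cofinal in I modulo finite sets form a σ-ideal.
Discarding the negligible open sets leaves a closed core C, every nonempty relatively open part of
which is cofinal. Baire category on C × C gives closed hereditary families L n, containing each
member of I up to a finite set, with unions of two members of L (n + 1) in L n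
(`exists_isClosedHereditary_halving`). As in Birkhoff–Kakutani metrization, giving members of L n
weight 2⁻ⁿ produces φ (`IsHalving.pieceUnions_subset`). The L n also refine a countable basis on C,
so that a set of norm zero is covered, up to a finite set, by two values of F
(`exists_diff_subset_union`) and hence lies in I. -/

/-! ### Limit points and asymptotic mass -/

section LimitPoints

variable {φ : Set ℕ → ℝ≥0∞} {X : Type*} [TopologicalSpace X]

theorem IsLSCSubmeasure.exhNorm_mono (hφ : IsLSCSubmeasure φ) {A B : Set ℕ} (h : A ⊆ B) :
    exhNorm φ A ≤ exhNorm φ B :=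
  iInf_mono fun _ => hφ.mono _ _ (sdiff_subset_sdiff_left h)

theorem IsLSCSubmeasure.exhNorm_le_of_finite_diff (hφ : IsLSCSubmeasure φ) {A B : Set ℕ}
    (h : (A \ B).Finite) : exhNorm φ A ≤ exhNorm φ B := by
  obtain ⟨N, hN⟩ := h.bddAbove
  refine le_iInf fun n => (iInf_le _ (max n (N + 1))).trans (hφ.mono _ _ ?_)
  rintro a ⟨ha, han⟩
  simp only [mem_Iio, not_lt, max_le_iff] at han
  refine ⟨?_, by simpa using han.1⟩
  by_contra hb
  have := hN ⟨ha, hb⟩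
  omega

/-- The asymptotic mass of the sequence `x` at `ℓ`. -/
noncomputable def limitMass (φ : Set ℕ → ℝ≥0∞) (x : ℕ → X) (ℓ : X) : ℝ≥0∞ :=
  ⨅ V ∈ 𝓝 ℓ, exhNorm φ {n | x n ∈ V}

theorem IsLSCSubmeasure.tendsto_limitMass (hφ : IsLSCSubmeasure φ) (x : ℕ → X) {ℓ : X}
    {U : ℕ → Set X} (hU : (𝓝 ℓ).HasAntitoneBasis U) :
    Tendsto (fun k => exhNorm φ {n | x n ∈ U k}) atTop (𝓝 (limitMass φ x ℓ)) := by
  have heq : limitMass φ x ℓ = ⨅ k, exhNorm φ {n | x n ∈ U k} := by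
    refine le_antisymm (le_iInf fun k => iInf₂_le _ (hU.mem k)) (le_iInf₂ fun V hV => ?_)
    obtain ⟨k, hk⟩ := hU.mem_iff.1 hV
    exact (iInf_le _ k).trans (hφ.exhNorm_mono fun n hn => hk hn)
  rw [heq]
  exact tendsto_atTop_iInf fun i j h => hφ.exhNorm_mono fun n hn => hU.antitone h hn

theorem upperSemicontinuous_limitMass (φ : Set ℕ → ℝ≥0∞) (x : ℕ → X) :
    UpperSemicontinuous (limitMass φ x) := by
  intro ℓ c hc
  simp only [limitMass, iInf_lt_iff] at hc
  obtain ⟨V, hV, hlt⟩ := hc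
  filter_upwards [eventually_mem_nhds_iff.2 hV] with y hy
  exact (iInf₂_le V hy).trans_lt hlt

/-- By lower semicontinuity every tail of A k has a finite block of mass above q. B takes its k-th
block from A k, so blocks k and later all lie in A k. -/
theorem IsLSCSubmeasure.exists_subset_of_lt_exhNorm (hφ : IsLSCSubmeasure φ) {q : ℝ≥0∞}
    {A : ℕ → Set ℕ} (hA : Antitone A) (h : ∀ k, q < exhNorm φ (A k)) :
    ∃ B : Set ℕ, q ≤ exhNorm φ B ∧ ∀ k, (B \ A k).Finite := by
  have step : ∀ k n, ∃ m, n < m ∧ q < φ ((A k \ Iio n) ∩ Iio m) := fun k n =>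
    ((eventually_gt_atTop n).and
      ((hφ.lsc _).eventually (lt_mem_nhds ((h k).trans_le (iInf_le _ n))))).exists
  choose g hg hgq using step
  let m : ℕ → ℕ := fun k => Nat.rec 0 (fun k n => g k n) k
  have hm : StrictMono m := strictMono_nat_of_lt_succ fun k => hg k (m k)
  refine ⟨⋃ k, (A k \ Iio (m k)) ∩ Iio (m (k + 1)), le_iInf fun n => ?_, fun k => ?_⟩
  -- Block n starts at m n ≥ n, so it survives the removal of `Iio n`.
  · refine (hgq n (m n)).le.trans (hφ.mono _ _ fun a ha => ⟨mem_iUnion.2 ⟨n, ha⟩, ?_⟩)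
    have h1 : ¬ a < m n := ha.1.2
    have h2 := hm.le_apply (x := n)
    simp only [mem_Iio]
    omega
  · refine (finite_Iio (m k)).subset ?_
    rintro a ⟨ha, hak⟩
    obtain ⟨j, ⟨haj, -⟩, hja⟩ := mem_iUnion.1 ha
    by_contra hlt
    have hkj : k < j + 1 := hm.lt_iff_lt.1 ((not_lt.1 hlt).trans_lt hja)
    exact hak (hA (by omega) haj)

theorem idealLimitPoints_eq [FirstCountableTopology X] (x : ℕ → X) (I : Order.Ideal (Set ℕ))
    (hfin : ∀ F : Set ℕ, F.Finite → F ∈ I) (hφ : IsLSCSubmeasure φ)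
    (hI : (I : Set (Set ℕ)) = exhFamily φ) :
    idealLimitPoints I x = {ℓ | 0 < limitMass φ x ℓ} := by
  have hmem : ∀ A, A ∈ I ↔ exhNorm φ A = 0 := fun A => by
    rw [← SetLike.mem_coe, hI]; rfl
  ext ℓ
  constructor
  · rintro ⟨s, hs, hsI, hlim⟩
    rw [hmem] at hsI
    refine (pos_iff_ne_zero.2 hsI).trans_le (le_iInf₂ fun V hV =>
      hφ.exhNorm_le_of_finite_diff ?_)
    obtain ⟨N, hN⟩ := eventually_atTop.1 (hlim.eventually hV)
    refine ((finite_Iio N).image s).subset ?_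
    rintro _ ⟨⟨k, rfl⟩, hk⟩
    exact ⟨k, not_le.1 fun hle => hk (hN k hle), rfl⟩
  · intro hℓ
    obtain ⟨U, hU⟩ := (𝓝 ℓ).exists_antitone_basis
    obtain ⟨q, hq0, hq⟩ := exists_between (mem_ofPred.1 hℓ)
    obtain ⟨B, hB, hBU⟩ := hφ.exists_subset_of_lt_exhNorm (A := fun k => {n | x n ∈ U k})
      (fun i j h n hn => hU.antitone h hn)
      (fun k => hq.trans_le (iInf₂_le _ (hU.mem k)))
    have hBI : B ∉ I := fun hmemB => (hq0.trans_le hB).ne' ((hmem B).1 hmemB)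
    have hinf : B.Infinite := fun hf => hBI (hfin B hf)
    have hrange : range (Nat.nth (· ∈ B)) = B := Nat.range_nth_of_infinite hinf
    have hmono : StrictMono (Nat.nth (· ∈ B)) := Nat.nth_strictMono hinf
    refine ⟨Nat.nth (· ∈ B), hmono, by rwa [hrange], hU.1.tendsto_right_iff.2 fun k _ => ?_⟩
    obtain ⟨N, hN⟩ := (hBU k).bddAbove
    filter_upwards [eventually_gt_atTop N] with j hj
    by_contra hcon
    have hjB : Nat.nth (· ∈ B) j ∈ B := Nat.nth_mem_of_infinite hinf j
    have := hN ⟨hjB, hcon⟩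
    have := hmono.le_apply (x := j)
    omega

theorem UpperSemicontinuous.isFSigma_pos {u : X → ℝ≥0∞} (hu : UpperSemicontinuous u) :
    IsFSigma {ℓ | 0 < u ℓ} := by
  -- For n = 0 the inverse is ∞, which only adds the closed set {u = ∞}.
  refine ⟨fun n => u ⁻¹' Ici ((n : ℝ≥0∞)⁻¹), fun n => hu.isClosed_preimage _, ?_⟩
  ext ℓ
  simp only [mem_ofPred_eq, mem_iUnion, mem_preimage, mem_Ici]
  constructor
  · intro h
    obtain ⟨n, hn⟩ := ENNReal.exists_inv_nat_lt h.ne'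
    exact ⟨n, hn.le⟩
  · rintro ⟨n, hn⟩
    exact (ENNReal.inv_pos.2 (ENNReal.natCast_ne_top n)).trans_le hn

end LimitPoints

/-! ### From halving families to a submeasure -/

section Submeasure

/-- The sets covered by pieces from the families `L n`, where `n` runs through the list. -/
def pieceUnions (L : ℕ → Set (Set ℕ)) : List ℕ → Set (Set ℕ)
  | [] => {∅}
  | n :: l => {A | ∃ a ∈ L n, ∃ b ∈ pieceUnions L l, A = a ∪ b}

variable {L : ℕ → Set (Set ℕ)}

theorem pieceUnions_perm {l l' : List ℕ} (h : l.Perm l') :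
    pieceUnions L l = pieceUnions L l' := by
  induction h with
  | nil => rfl
  | cons n _ ih => simp only [pieceUnions, ih]
  | swap m n l =>
    ext A
    constructor <;>
    · rintro ⟨a, ha, _, ⟨b, hb, c, hc, rfl⟩, rfl⟩
      exact ⟨b, hb, _, ⟨a, ha, c, hc, rfl⟩, union_left_comm _ _ _⟩
  | trans _ _ ih₁ ih₂ => exact ih₁.trans ih₂

theorem union_mem_pieceUnions_append {A B : Set ℕ} {l l' : List ℕ}
    (hA : A ∈ pieceUnions L l) (hB : B ∈ pieceUnions L l') :
    A ∪ B ∈ pieceUnions L (l ++ l') := by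
  induction l generalizing A with
  | nil =>
    obtain rfl : A = ∅ := hA
    simpa using hB
  | cons n l ih =>
    obtain ⟨a, ha, b, hb, rfl⟩ := hA
    exact ⟨a, ha, _, ih hb, union_assoc _ _ _⟩

theorem pieceUnions_of_subset (hlow : ∀ n, IsLowerSet (L n)) {A B : Set ℕ} (h : A ⊆ B)
    {l : List ℕ} (hB : B ∈ pieceUnions L l) : A ∈ pieceUnions L l := by
  induction l generalizing A B with
  | nil =>
    obtain rfl : B = ∅ := hB
    exact subset_empty_iff.1 h
  | cons n l ih =>
    obtain ⟨a, ha, b, hb, rfl⟩ := hB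
    refine ⟨A ∩ a, hlow n inter_subset_right ha, A ∩ b, ih inter_subset_right hb, ?_⟩
    rw [← inter_union_distrib_left, inter_eq_left.2 h]

/-- The total weight of a list of indices, the index `n` having weight `2⁻ⁿ`. -/
noncomputable def listWeight (l : List ℕ) : ℝ≥0∞ := (l.map fun n => (2⁻¹ : ℝ≥0∞) ^ n).sum

theorem listWeight_cons (n : ℕ) (l : List ℕ) :
    listWeight (n :: l) = 2⁻¹ ^ n + listWeight l := by
  simp [listWeight]

theorem listWeight_perm {l l' : List ℕ} (h : l.Perm l') : listWeight l = listWeight l' :=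
  (h.map _).sum_eq

theorem two_inv_pow_succ_add_self (n : ℕ) :
    (2⁻¹ : ℝ≥0∞) ^ (n + 1) + 2⁻¹ ^ (n + 1) = 2⁻¹ ^ n := by
  rw [pow_succ, ← mul_add, ENNReal.inv_two_add_inv_two, mul_one]

theorem two_inv_pow_le_iff {m n : ℕ} : (2⁻¹ : ℝ≥0∞) ^ m ≤ 2⁻¹ ^ n ↔ n ≤ m := by
  rw [← ENNReal.inv_pow, ← ENNReal.inv_pow, ENNReal.inv_le_inv]
  exact_mod_cast Nat.pow_le_pow_iff_right one_lt_two

/-- Families each of which contains all unions of two members of the next one. -/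
structure IsHalving (L : ℕ → Set (Set ℕ)) : Prop where
  empty_mem : ∀ n, ∅ ∈ L n
  union_mem : ∀ n, ∀ a ∈ L (n + 1), ∀ b ∈ L (n + 1), a ∪ b ∈ L n

theorem IsHalving.antitone (hL : IsHalving L) : Antitone L :=
  antitone_nat_of_succ_le fun n a ha => by
    simpa using hL.union_mem n a ha ∅ (hL.empty_mem _)

/-- Unions are absorbed from the tail: head and remaining pieces both lie in L n ⊆ L (i + 1), so
their union lies in L i. -/
theorem IsHalving.pieceUnions_subset_of_pairwise_lt (hL : IsHalving L) {l : List ℕ}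
    (hl : l.Pairwise (· < ·)) {i : ℕ} (hi : ∀ n ∈ l, i < n) : pieceUnions L l ⊆ L i := by
  induction l generalizing i with
  | nil =>
    rintro _ rfl
    exact hL.empty_mem i
  | cons n l ih =>
    rintro _ ⟨a, ha, b, hb, rfl⟩
    rw [List.pairwise_cons] at hl
    have hin : i + 1 ≤ n := hi n (by simp)
    exact hL.union_mem i a (hL.antitone hin ha) b (hL.antitone hin (ih hl.2 hl.1 hb))

theorem IsHalving.pieceUnions_subset_of_nodup (hL : IsHalving L) {l : List ℕ}
    (hl : l.Nodup) {i : ℕ} (hi : ∀ n ∈ l, i < n) : pieceUnions L l ⊆ L i := by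
  have hperm := List.perm_insertionSort (· ≤ ·) l
  rw [← pieceUnions_perm hperm]
  refine hL.pieceUnions_subset_of_pairwise_lt ?_ fun n hn => hi n (hperm.mem_iff.1 hn)
  exact ((List.pairwise_insertionSort (· ≤ ·) l).and (hperm.nodup_iff.2 hl)).imp
    fun h => lt_of_le_of_ne h.1 h.2

/-- This is binary carrying: two pieces of index n + 1 merge into one of index n without changing
the weight, until the indices are distinct. -/
theorem IsHalving.pieceUnions_subset (hL : IsHalving L) {l : List ℕ} {i : ℕ}
    (hl : listWeight l ≤ 2⁻¹ ^ i) : pieceUnions L l ⊆ L i := by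
  induction hk : l.length using Nat.strong_induction_on generalizing l with
  | _ k ih =>
    by_cases hnd : l.Nodup
    · by_cases hi : ∀ n ∈ l, i < n
      · exact hL.pieceUnions_subset_of_nodup hnd hi
      -- An index n ≤ i alone exhausts the permitted weight, so n = i and the list has no other
      -- entry.
      · push Not at hi
        obtain ⟨n, hn, hni⟩ := hi
        obtain ⟨l', hperm⟩ : ∃ l', l.Perm (n :: l') := ⟨_, List.perm_cons_erase hn⟩
        rw [listWeight_perm hperm, listWeight_cons] at hl
        obtain rfl : n = i := hni.antisymm (two_inv_pow_le_iff.1 (le_self_add.trans hl))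
        have hzero : listWeight l' = 0 := by
          by_contra hne
          exact (ENNReal.lt_add_right (by simp) hne).not_ge hl
        obtain rfl : l' = [] := by
          cases l' with
          | nil => rfl
          | cons m l' => simp [listWeight_cons] at hzero
        rw [pieceUnions_perm hperm]
        rintro _ ⟨a, ha, _, rfl, rfl⟩
        simpa using ha
    · obtain ⟨n, hn⟩ := List.exists_duplicate_iff_not_nodup.2 hnd
      obtain ⟨l', hperm⟩ := (List.duplicate_iff_sublist.1 hn).exists_perm_append
      replace hperm : l.Perm (n :: n :: l') := hperm
      rw [listWeight_perm hperm, listWeight_cons, listWeight_cons, ← add_assoc] at hl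
      cases n with
      | zero =>
        have h2 : (2 : ℝ≥0∞) ≤ 1 := by
          calc (2 : ℝ≥0∞) = 2⁻¹ ^ 0 + 2⁻¹ ^ 0 := by norm_num
            _ ≤ _ := le_self_add
            _ ≤ _ := hl
            _ ≤ 1 := pow_le_one₀ (by simp) (by norm_num)
        norm_num at h2
      | succ n =>
        rw [two_inv_pow_succ_add_self, ← listWeight_cons] at hl
        rw [pieceUnions_perm hperm]
        rintro _ ⟨a, ha, _, ⟨b, hb, c, hc, rfl⟩, rfl⟩
        rw [← union_assoc]
        refine ih (l'.length + 1) ?_ hl rfl ⟨_, hL.union_mem n a ha b hb, c, hc, rfl⟩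
        rw [← hk, hperm.length_eq]
        simp

/-- The least total weight of a finite cover of `A` by pieces. -/
noncomputable def coverWeight (L : ℕ → Set (Set ℕ)) (A : Set ℕ) : ℝ≥0∞ :=
  ⨅ (l : List ℕ) (_ : A ∈ pieceUnions L l), listWeight l

theorem coverWeight_le {A : Set ℕ} {l : List ℕ} (h : A ∈ pieceUnions L l) :
    coverWeight L A ≤ listWeight l :=
  iInf₂_le l h

theorem coverWeight_empty : coverWeight L ∅ = 0 :=
  le_antisymm ((coverWeight_le (l := []) rfl).trans (by simp [listWeight])) zero_le

theorem coverWeight_mono (hlow : ∀ n, IsLowerSet (L n)) {A B : Set ℕ} (h : A ⊆ B) :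
    coverWeight L A ≤ coverWeight L B :=
  le_iInf₂ fun _ hl => coverWeight_le (pieceUnions_of_subset hlow h hl)

theorem coverWeight_union_le (A B : Set ℕ) :
    coverWeight L (A ∪ B) ≤ coverWeight L A + coverWeight L B := by
  simp only [coverWeight, ENNReal.iInf_add, ENNReal.add_iInf]
  refine le_iInf₂ fun l hl => le_iInf₂ fun l' hl' => ?_
  refine (coverWeight_le (union_mem_pieceUnions_append hl' hl)).trans (le_of_eq ?_)
  simp [listWeight]

theorem coverWeight_le_of_mem {A : Set ℕ} {n : ℕ} (h : A ∈ L n) :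
    coverWeight L A ≤ 2⁻¹ ^ n :=
  (coverWeight_le (l := [n]) ⟨A, h, ∅, rfl, by simp⟩).trans (by simp [listWeight])

theorem IsHalving.mem_of_coverWeight_lt (hL : IsHalving L) {A : Set ℕ} {n : ℕ}
    (h : coverWeight L A < 2⁻¹ ^ n) : A ∈ L n := by
  simp only [coverWeight, iInf_lt_iff] at h
  obtain ⟨l, hl, hlt⟩ := h
  exact hL.pieceUnions_subset hlt.le hl

/-- A family of sets which is hereditary and closed in the Cantor topology. -/
structure IsClosedHereditary (K : Set (Set ℕ)) : Prop where
  isLowerSet : IsLowerSet K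
  mem_of_initial : ∀ A, (∀ n, A ∩ Iio n ∈ K) → A ∈ K

/-- The lower semicontinuous submeasure generated by the families `L n`. -/
noncomputable def coverSubmeasure (L : ℕ → Set (Set ℕ)) (A : Set ℕ) : ℝ≥0∞ :=
  ⨆ n, coverWeight L (A ∩ Iio n)

theorem coverSubmeasure_inter_Iio (hlow : ∀ n, IsLowerSet (L n)) (A : Set ℕ) (n : ℕ) :
    coverSubmeasure L (A ∩ Iio n) = coverWeight L (A ∩ Iio n) :=
  le_antisymm (iSup_le fun _ => coverWeight_mono hlow inter_subset_left)
    (le_iSup_of_le n (by rw [inter_assoc, inter_self]))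

theorem isLSCSubmeasure_coverSubmeasure (hlow : ∀ n, IsLowerSet (L n)) :
    IsLSCSubmeasure (coverSubmeasure L) where
  empty := by simp [coverSubmeasure, coverWeight_empty]
  mono A B h := iSup_mono fun n => coverWeight_mono hlow (inter_subset_inter_left _ h)
  union_le A B := iSup_le fun n => by
    rw [union_inter_distrib_right]
    exact (coverWeight_union_le _ _).trans
      (add_le_add (le_iSup (fun n => coverWeight L (A ∩ Iio n)) n)
        (le_iSup (fun n => coverWeight L (B ∩ Iio n)) n))
  lsc A := by
    simp only [coverSubmeasure_inter_Iio hlow]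
    exact tendsto_atTop_iSup fun m n h =>
      coverWeight_mono hlow (inter_subset_inter_right _ (Iio_subset_Iio h))

theorem coverSubmeasure_le_of_mem (hlow : ∀ n, IsLowerSet (L n)) {A : Set ℕ} {n : ℕ}
    (h : A ∈ L n) : coverSubmeasure L A ≤ 2⁻¹ ^ n :=
  iSup_le fun _ => coverWeight_le_of_mem (hlow n inter_subset_left h)

theorem IsHalving.mem_of_coverSubmeasure_lt (hL : IsHalving L)
    (hcl : ∀ n, IsClosedHereditary (L n)) {A : Set ℕ} {n : ℕ}
    (h : coverSubmeasure L A < 2⁻¹ ^ n) : A ∈ L n :=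
  (hcl n).mem_of_initial A fun m => hL.mem_of_coverWeight_lt
    ((le_iSup (fun m => coverWeight L (A ∩ Iio m)) m).trans_lt h)

/-- Membership in L i and mass below 2⁻ⁱ control each other, so the tails of A have mass tending to
0 exactly when they enter every L i. -/
theorem IsHalving.exhNorm_coverSubmeasure_eq_zero_iff (hL : IsHalving L)
    (hcl : ∀ n, IsClosedHereditary (L n)) (A : Set ℕ) :
    exhNorm (coverSubmeasure L) A = 0 ↔ ∀ i, ∃ n, A \ Iio n ∈ L i := by
  constructor
  · intro h i
    have hlt : exhNorm (coverSubmeasure L) A < 2⁻¹ ^ i := by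
      rw [h]
      exact ENNReal.pow_pos (by simp) i
    obtain ⟨n, hn⟩ := iInf_lt_iff.1 hlt
    exact ⟨n, hL.mem_of_coverSubmeasure_lt hcl hn⟩
  · intro h
    refine le_antisymm (ge_of_tendsto' (ENNReal.tendsto_pow_atTop_nhds_zero_of_lt_one
      (r := 2⁻¹) (by norm_num)) fun i => ?_) zero_le
    obtain ⟨n, hn⟩ := h i
    exact (iInf_le _ n).trans (coverSubmeasure_le_of_mem (fun n => (hcl n).isLowerSet) hn)

end Submeasure

/-! ### Capturing sets and closed hereditary families -/

section Solecki

variable {I : Order.Ideal (Set ℕ)}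

/-- Every member of `I` is almost contained in some `F a` with `a ∈ V`. -/
def Captures {Z : Type*} (I : Order.Ideal (Set ℕ)) (F : Z → Set ℕ) (V : Set Z) : Prop :=
  ∀ A ∈ I, ∃ a ∈ V, (A \ F a).Finite

/-- The sets all of whose finite initial segments are contained in some `F a` with `a ∈ V`. -/
def initialCover {Z : Type*} (F : Z → Set ℕ) (V : Set Z) : Set (Set ℕ) :=
  {A | ∀ n, ∃ a ∈ V, A ∩ Iio n ⊆ F a}

/-- Every member of `I` belongs to `K` after removal of an initial segment. -/
def EventuallyContains (K : Set (Set ℕ)) (I : Order.Ideal (Set ℕ)) : Prop :=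
  ∀ A ∈ I, ∃ n, A \ Iio n ∈ K

section General

variable {Z : Type*} {F : Z → Set ℕ} {V W : Set Z}

theorem Captures.mono (h : Captures I F V) (hVW : V ⊆ W) : Captures I F W := fun A hA =>
  let ⟨a, ha, hfin⟩ := h A hA
  ⟨a, hVW ha, hfin⟩

/-- If B n witnesses the failure for W n, a pseudo-union A ∈ I of all B n defeats every W n at once.
-/
theorem Captures.exists_of_subset_iUnion (hP : IsPIdeal I) (h : Captures I F V)
    {W : ℕ → Set Z} (hW : V ⊆ ⋃ n, W n) : ∃ n, Captures I F (W n) := by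
  by_contra! hcon
  simp only [Captures, not_forall, not_exists, not_and] at hcon
  choose B hBI hB using hcon
  obtain ⟨A, hA, hBA⟩ := hP B hBI
  obtain ⟨a, haV, ha⟩ := h A hA
  obtain ⟨n, hn⟩ := mem_iUnion.1 (hW haV)
  refine hB n a hn (((hBA n).union ha).subset fun k hk => ?_)
  by_cases hkA : k ∈ A
  · exact Or.inr ⟨hkA, hk.2⟩
  · exact Or.inl ⟨hk.1, hkA⟩

/-- `initialCover F V` is the closure of the hereditary hull of F '' V. -/
theorem isClosedHereditary_initialCover (F : Z → Set ℕ) (V : Set Z) :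
    IsClosedHereditary (initialCover F V) where
  isLowerSet _ _ h hA n :=
    let ⟨a, ha, hsub⟩ := hA n
    ⟨a, ha, (inter_subset_inter_left _ h).trans hsub⟩
  mem_of_initial A hA n := by
    obtain ⟨a, ha, hsub⟩ := hA n n
    exact ⟨a, ha, by rwa [inter_assoc, inter_self] at hsub⟩

theorem initialCover_mono (h : V ⊆ W) : initialCover F V ⊆ initialCover F W :=
  fun _ hA n =>
    let ⟨a, ha, hsub⟩ := hA n
    ⟨a, h ha, hsub⟩

theorem Captures.eventuallyContains (h : Captures I F V) :
    EventuallyContains (initialCover F V) I := by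
  intro A hA
  obtain ⟨a, ha, hfin⟩ := h A hA
  obtain ⟨N, hN⟩ := hfin.bddAbove
  refine ⟨N + 1, fun n => ⟨a, ha, ?_⟩⟩
  rintro k ⟨⟨hkA, hk⟩, -⟩
  by_contra hkF
  have := hN ⟨hkA, hkF⟩
  simp only [mem_Iio] at hk
  omega

theorem IsClosedHereditary.inter {K K' : Set (Set ℕ)} (h : IsClosedHereditary K)
    (h' : IsClosedHereditary K') : IsClosedHereditary (K ∩ K') where
  isLowerSet := h.isLowerSet.inter h'.isLowerSet
  mem_of_initial A hA :=
    ⟨h.mem_of_initial A fun n => (hA n).1, h'.mem_of_initial A fun n => (hA n).2⟩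

theorem isClosedHereditary_Iic (B : Set ℕ) : IsClosedHereditary (Iic B) where
  isLowerSet := isLowerSet_Iic B
  mem_of_initial A hA := fun k hk => hA (k + 1) ⟨hk, by simp⟩

theorem EventuallyContains.inter {K K' : Set (Set ℕ)} (h : EventuallyContains K I)
    (h' : EventuallyContains K' I) (hK : IsLowerSet K) (hK' : IsLowerSet K') :
    EventuallyContains (K ∩ K') I := by
  intro A hA
  obtain ⟨m, hm⟩ := h A hA
  obtain ⟨n, hn⟩ := h' A hA
  exact ⟨max m n,
    hK (sdiff_subset_sdiff_right (Iio_subset_Iio (le_max_left m n))) hm,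
    hK' (sdiff_subset_sdiff_right (Iio_subset_Iio (le_max_right m n))) hn⟩

theorem eventuallyContains_Iic_compl_Iio (n : ℕ) :
    EventuallyContains (Iic (Iio n)ᶜ) I := fun _ _ => ⟨n, fun _ hk => hk.2⟩

theorem Order.Ideal.mem_of_finite_diff (hfin : ∀ F : Set ℕ, F.Finite → F ∈ I) {A B : Set ℕ}
    (hB : B ∈ I) (h : (A \ B).Finite) : A ∈ I :=
  I.lower (fun k hk => by by_cases hkB : k ∈ B <;> simp [hk, hkB])
    (Order.Ideal.sup_mem (hfin _ h) hB)

end General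

/-! ### The core and the Baire category argument -/

section Topological

variable {Z : Type*} [TopologicalSpace Z] {F : Z → Set ℕ}

/-- The map `F` into the power set of `ℕ` is continuous for the Cantor topology. -/
def IsCantorContinuous (F : Z → Set ℕ) : Prop :=
  ∀ a n, ∀ᶠ b in 𝓝 a, F b ∩ Iio n = F a ∩ Iio n

theorem Continuous.isCantorContinuous {f : Z → ℕ → Bool} (hf : Continuous f) :
    IsCantorContinuous fun a => {n | f a n = true} := by
  intro a n
  have : ∀ᶠ b in 𝓝 a, ∀ i ∈ Iio n, f b i = f a i :=
    (eventually_all_finite (finite_Iio n)).2 fun i _ =>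
      ((continuous_apply i).comp hf).continuousAt.eventually
        (IsOpen.mem_nhds (isOpen_discrete {f a i}) rfl)
  filter_upwards [this] with b hb
  ext i
  constructor
  · rintro ⟨h1, h2⟩
    exact ⟨(hb i h2).symm.trans h1, h2⟩
  · rintro ⟨h1, h2⟩
    exact ⟨(hb i h2).trans h1, h2⟩

/-- The points all of whose open neighborhoods capture the ideal. -/
def captureCore (I : Order.Ideal (Set ℕ)) (F : Z → Set ℕ) : Set Z :=
  {a | ∀ U, IsOpen U → a ∈ U → Captures I F U}

theorem isClosed_captureCore (I : Order.Ideal (Set ℕ)) (F : Z → Set ℕ) :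
    IsClosed (captureCore I F) := by
  rw [← isOpen_compl_iff, isOpen_iff_mem_nhds]
  intro a ha
  obtain ⟨U, hU, haU, hcap⟩ : ∃ U, IsOpen U ∧ a ∈ U ∧ ¬ Captures I F U := by
    simpa [captureCore] using ha
  exact mem_of_superset (hU.mem_nhds haU) fun b hb hbC => hcap (hbC U hU hb)

theorem Captures.inter_captureCore [SecondCountableTopology Z] (hP : IsPIdeal I)
    {U : Set Z} (h : Captures I F U) : Captures I F (U ∩ captureCore I F) := by
  classical
  obtain ⟨b, hb⟩ := (TopologicalSpace.countable_countableBasis Z).insert ∅ |>.exists_eq_range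
    (insert_nonempty _ _)
  have hbasis := TopologicalSpace.isBasis_countableBasis Z
  have hbopen : ∀ n, IsOpen (b n) := fun n => by
    have : b n ∈ insert ∅ (TopologicalSpace.countableBasis Z) := hb ▸ mem_range_self n
    rcases this with h | h
    · exact h ▸ isOpen_empty
    · exact hbasis.isOpen h
  have hsmall : ∀ a V, IsOpen V → a ∈ V → ∃ n, a ∈ b n ∧ b n ⊆ V := fun a V hV ha => by
    obtain ⟨B, hB, haB, hBV⟩ := hbasis.exists_subset_of_mem_open ha hV
    obtain ⟨n, rfl⟩ : B ∈ range b := hb ▸ mem_insert_of_mem _ hB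
    exact ⟨n, haB, hBV⟩
  -- Points of U outside the core lie in non-capturing basic sets. One member of this cover
  -- captures, and it can only be U ∩ core.
  obtain ⟨n, hn⟩ := h.exists_of_subset_iUnion hP
    (W := fun n => if Captures I F (b n) then U ∩ captureCore I F else b n) (by
      intro a ha
      rw [mem_iUnion]
      by_cases haC : a ∈ captureCore I F
      · obtain ⟨n, hn, -⟩ := hsmall a univ isOpen_univ trivial
        exact ⟨n, by rw [if_pos (haC _ (hbopen n) hn)]; exact ⟨ha, haC⟩⟩
      · obtain ⟨V, hV, haV, hcap⟩ : ∃ V, IsOpen V ∧ a ∈ V ∧ ¬ Captures I F V := by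
          simpa [captureCore] using haC
        obtain ⟨n, hn, hnV⟩ := hsmall a V hV haV
        exact ⟨n, by rw [if_neg fun h => hcap (h.mono hnV)]; exact hn⟩)
  by_cases hbn : Captures I F (b n)
  · rwa [if_pos hbn] at hn
  · rw [if_neg hbn] at hn
    exact absurd hn hbn

theorem captures_inter_captureCore [SecondCountableTopology Z] (hP : IsPIdeal I) {U : Set Z}
    (hU : IsOpen U) (hne : (U ∩ captureCore I F).Nonempty) :
    Captures I F (U ∩ captureCore I F) :=
  let ⟨_, haU, haC⟩ := hne
  (haC U hU haU).inter_captureCore hP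

/-- Failure of membership in K is visible on a finite window, where F is locally constant; heredity
of K carries it back to the full set. -/
theorem isClosed_setOf_union_diff_mem (hF : IsCantorContinuous F) {K : Set (Set ℕ)}
    (hK : IsClosedHereditary K) (n : ℕ) :
    IsClosed {p : Z × Z | (F p.1 ∪ F p.2) \ Iio n ∈ K} := by
  rw [← isOpen_compl_iff, isOpen_iff_mem_nhds]
  rintro ⟨a, b⟩ hab
  obtain ⟨m, hm⟩ : ∃ m, ((F a ∪ F b) \ Iio n) ∩ Iio m ∉ K := by
    by_contra! hcon
    exact hab (hK.mem_of_initial _ hcon)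
  filter_upwards [prod_mem_nhds (hF a m) (hF b m)]
  rintro ⟨a', b'⟩ ⟨ha', hb'⟩ hmem
  refine hm (hK.isLowerSet ?_ hmem)
  rintro k ⟨⟨hk, hkn⟩, hkm⟩
  refine ⟨hk.imp (fun h => ?_) (fun h => ?_), hkn⟩
  · exact (ha'.symm ▸ (⟨h, hkm⟩ : k ∈ F a ∩ Iio m) : k ∈ F a' ∩ Iio m).1
  · exact (hb'.symm ▸ (⟨h, hkm⟩ : k ∈ F b ∩ Iio m) : k ∈ F b' ∩ Iio m).1

/-- Closed sets indexed by n cover C × C, as I is closed under unions; one contains an open box U ×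
V. The family K' approximates its members from both sides of the box, so a union of two members can
use one side for each. Both sides capture I, by the choice of C. -/
theorem exists_isClosedHereditary_halving [PolishSpace Z] (hP : IsPIdeal I)
    (hF : IsCantorContinuous F) (hFI : ∀ a, F a ∈ I) (huniv : Captures I F univ)
    {K : Set (Set ℕ)} (hK : IsClosedHereditary K) (hKI : EventuallyContains K I) :
    ∃ K', IsClosedHereditary K' ∧ EventuallyContains K' I ∧
      ∀ a ∈ K', ∀ b ∈ K', a ∪ b ∈ K := by
  set C := captureCore I F
  have : PolishSpace C := (isClosed_captureCore I F).polishSpace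
  have : Nonempty C := by
    obtain ⟨a, ⟨-, ha⟩, -⟩ := huniv.inter_captureCore hP ∅ I.bot_mem
    exact ⟨a, ha⟩
  have hFC : IsCantorContinuous fun a : C => F a := fun a n =>
    continuous_subtype_val.continuousAt.eventually (hF a n)
  obtain ⟨n, ⟨a, b⟩, hint⟩ := nonempty_interior_of_iUnion_of_closed
    (fun n => isClosed_setOf_union_diff_mem hFC hK n)
    (eq_univ_of_forall fun p => mem_iUnion.2
      (hKI _ (Order.Ideal.sup_mem (hFI p.1) (hFI p.2))))
  rw [mem_interior_iff_mem_nhds, mem_nhds_prod_iff] at hint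
  obtain ⟨U₀, hU₀, V₀, hV₀, hUV⟩ := hint
  obtain ⟨U₁, hU₁, hUU⟩ := mem_nhds_subtype _ _ _ |>.1 hU₀
  obtain ⟨V₁, hV₁, hVV⟩ := mem_nhds_subtype _ _ _ |>.1 hV₀
  obtain ⟨U, hUsub, hU, haU⟩ := mem_nhds_iff.1 hU₁
  obtain ⟨V, hVsub, hV, hbV⟩ := mem_nhds_iff.1 hV₁
  have hKU := isClosedHereditary_initialCover F (U ∩ C)
  have hKV := isClosedHereditary_initialCover F (V ∩ C)
  refine ⟨(initialCover F (U ∩ C) ∩ initialCover F (V ∩ C)) ∩ Iic (Iio n)ᶜ,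
    (hKU.inter hKV).inter (isClosedHereditary_Iic _),
    (((captures_inter_captureCore hP hU ⟨a, haU, a.2⟩).eventuallyContains.inter
      (captures_inter_captureCore hP hV ⟨b, hbV, b.2⟩).eventuallyContains
      hKU.isLowerSet hKV.isLowerSet).inter (eventuallyContains_Iic_compl_Iio n)
      (hKU.inter hKV).isLowerSet (isLowerSet_Iic _)), ?_⟩
  rintro A ⟨⟨hAU, -⟩, hAn⟩ B ⟨⟨-, hBV⟩, hBn⟩
  refine hK.mem_of_initial _ fun m => ?_
  obtain ⟨c, ⟨hcU, hcC⟩, hc⟩ := hAU m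
  obtain ⟨d, ⟨hdV, hdC⟩, hd⟩ := hBV m
  have hcd : (F c ∪ F d) \ Iio n ∈ K :=
    @hUV (⟨c, hcC⟩, ⟨d, hdC⟩) ⟨hUU (hUsub hcU), hVV (hVsub hdV)⟩
  refine hK.isLowerSet ?_ hcd
  rintro k ⟨hk | hk, hkm⟩
  · exact ⟨Or.inl (hc ⟨hk, hkm⟩), hAn hk⟩
  · exact ⟨Or.inr (hd ⟨hk, hkm⟩), hBn hk⟩

end Topological

/-! ### Branches in Baire space and the reverse inclusion -/

theorem exists_forall_mem_cylinder {a : ℕ → ℕ → ℕ} {p : ℕ → ℕ} (hp : StrictMono p)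
    (ha : ∀ j, a (j + 1) ∈ PiNat.cylinder (a j) (p j)) :
    ∃ c, ∀ j, c ∈ PiNat.cylinder (a j) (p j) := by
  have hstable : ∀ j k i, i < p j → a (j + k) i = a j i := by
    intro j k i hi
    induction k with
    | zero => rfl
    | succ k ih => exact (ha (j + k) i (hi.trans_le (hp.monotone (by omega)))).trans ih
  -- Since p (i + 1) > i, the coordinate i is frozen from a (i + 1) on.
  refine ⟨fun i => a (i + 1) i, fun j i hi => ?_⟩
  have hi' : i < p (i + 1) := hp.le_apply (x := i + 1)
  rcases le_total j (i + 1) with h | h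
  · obtain ⟨k, hk⟩ := Nat.exists_eq_add_of_le h
    simpa [hk] using hstable j k i hi
  · obtain ⟨k, rfl⟩ := Nat.exists_eq_add_of_le h
    exact (hstable (i + 1) k i hi').symm

theorem exists_mem_Ico_succ {m : ℕ → ℕ} (hm : StrictMono m) {k : ℕ} (hk : m 0 ≤ k) :
    ∃ i, m i ≤ k ∧ k < m (i + 1) := by
  by_contra! hcon
  have : ∀ i, m i ≤ k := fun i => by
    induction i with
    | zero => exact hk
    | succ i ih => exact hcon i ih
  have h1 := this (k + 1)
  have h2 := hm.le_apply (x := k + 1)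
  omega

/-- Two branches are built alternately. Once a branch is refined to cover a block of A, its new
cylinder handles A only beyond an uncontrolled threshold; the other branch covers A up to there. -/
theorem exists_diff_subset_union {F : (ℕ → ℕ) → Set ℕ} (hF : IsCantorContinuous F)
    {C : Set (ℕ → ℕ)} (hC : C.Nonempty) {A : Set ℕ}
    (hA : ∀ U, IsOpen U → (U ∩ C).Nonempty → ∃ n, A \ Iio n ∈ initialCover F (U ∩ C)) :
    ∃ c d n, A \ Iio n ⊆ F c ∪ F d := by
  let K : (ℕ → ℕ) × ℕ → Set (Set ℕ) := fun s =>
    initialCover F (PiNat.cylinder s.1 s.2 ∩ C)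
  have hcyl : ∀ s : (ℕ → ℕ) × ℕ, s.1 ∈ C → ∃ n, A \ Iio n ∈ K s := fun s hs =>
    hA _ (PiNat.isOpen_cylinder _ _ _) ⟨s.1, PiNat.self_mem_cylinder _ _, hs⟩
  -- A state holds the cylinder to be refined now, the waiting cylinder, and a threshold beyond
  -- which the first one handles A.
  let S : Type := {t : ((ℕ → ℕ) × ℕ) × ((ℕ → ℕ) × ℕ) × ℕ //
    t.1.1 ∈ C ∧ t.2.1.1 ∈ C ∧ A \ Iio t.2.2 ∈ K t.1}
  have step : ∀ s : S, ∃ t : S, t.1.1 = s.1.2.1 ∧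
      t.1.2.1.1 ∈ PiNat.cylinder s.1.1.1 s.1.1.2 ∧ s.1.1.2 < t.1.2.1.2 ∧
      s.1.2.2 < t.1.2.2 ∧
      ∀ c ∈ PiNat.cylinder t.1.2.1.1 t.1.2.1.2, ∀ k ∈ A, s.1.2.2 ≤ k → k < t.1.2.2 →
        k ∈ F c := by
    rintro ⟨⟨⟨a, p⟩, ⟨b, q⟩, m⟩, ha, hb, hm⟩
    obtain ⟨m₁, hm₁⟩ := hcyl (b, q) hb
    let m' := max m₁ (m + 1)
    -- The bound m' is past the threshold of the waiting cylinder, and F a' covers A on [m, m'). A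
    -- longer cylinder around a' fixes F below m', and then the roles swap.
    obtain ⟨a', ⟨ha'cyl, ha'C⟩, ha'⟩ := hm m'
    obtain ⟨_, ⟨c, r, rfl⟩, hac, hr⟩ := (PiNat.isTopologicalBasis_cylinders
      (fun _ : ℕ => ℕ)).mem_nhds_iff.1 (hF a' m')
    rw [PiNat.mem_cylinder_iff_eq] at hac
    rw [← hac] at hr
    refine ⟨⟨⟨(b, q), (a', max r (p + 1)), m'⟩, hb, ha'C,
      (isClosedHereditary_initialCover F _).isLowerSet
        (sdiff_subset_sdiff_right (Iio_subset_Iio (le_max_left _ _))) hm₁⟩,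
      rfl, ha'cyl, by simp, by simp [m'], ?_⟩
    intro c hc k hkA hmk hkm'
    have h1 : F c ∩ Iio m' = F a' ∩ Iio m' := hr (PiNat.cylinder_anti _ (le_max_left _ _) hc)
    have h2 : k ∈ F a' ∩ Iio m' := ⟨ha' ⟨⟨hkA, not_lt.2 hmk⟩, hkm'⟩, hkm'⟩
    exact (h1 ▸ h2).1
  choose g hg₁ hg₂ hg₃ hg₄ hg₅ using step
  obtain ⟨a₀, ha₀⟩ := hC
  obtain ⟨n₀, hn₀⟩ := hcyl (a₀, 0) ha₀
  let t : ℕ → S := fun i => Nat.rec ⟨⟨(a₀, 0), (a₀, 0), n₀⟩, ha₀, ha₀, hn₀⟩ (fun _ s => g s) i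
  have hsucc : ∀ i, t (i + 1) = g (t i) := fun _ => rfl
  let a : ℕ → ℕ → ℕ := fun i => (t i).1.1.1
  let p : ℕ → ℕ := fun i => (t i).1.1.2
  let m : ℕ → ℕ := fun i => (t i).1.2.2
  have ht : ∀ i, (t (i + 2)).1.1 = (t (i + 1)).1.2.1 := fun i => hg₁ (t (i + 1))
  have hacyl : ∀ i, a (i + 2) ∈ PiNat.cylinder (a i) (p i) := fun i => by
    simp only [a, p, ht]
    exact hg₂ (t i)
  have hp : ∀ i, p i < p (i + 2) := fun i => by
    simp only [p, ht]
    exact hg₃ (t i)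
  have hm : StrictMono m := strictMono_nat_of_lt_succ fun i => hg₄ (t i)
  have hcov : ∀ i, ∀ c ∈ PiNat.cylinder (a (i + 2)) (p (i + 2)), ∀ k ∈ A, m i ≤ k →
      k < m (i + 1) → k ∈ F c := fun i c hc => by
    simp only [a, p, ht] at hc
    exact hg₅ (t i) c hc
  -- Cylinders of equal parity are nested: even ones shrink to c, odd ones to d.
  have hlim : ∀ e, ∃ c, ∀ j, c ∈ PiNat.cylinder (a (2 * j + e)) (p (2 * j + e)) := fun e =>
    exists_forall_mem_cylinder (a := fun j => a (2 * j + e)) (p := fun j => p (2 * j + e))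
      (strictMono_nat_of_lt_succ fun j => by
        rw [show 2 * (j + 1) + e = 2 * j + e + 2 by ring]; exact hp _)
      (fun j => by
        simp only [show 2 * (j + 1) + e = 2 * j + e + 2 by ring]; exact hacyl _)
  obtain ⟨c, hc⟩ := hlim 0
  obtain ⟨d, hd⟩ := hlim 1
  refine ⟨c, d, m 0, ?_⟩
  rintro k ⟨hkA, hk⟩
  obtain ⟨i, hi₁, hi₂⟩ := exists_mem_Ico_succ hm (not_lt.1 hk)
  obtain ⟨j, rfl | rfl⟩ := i.even_or_odd'
  · exact Or.inl (hcov (2 * j) c (hc (j + 1)) k hkA hi₁ hi₂)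
  · exact Or.inr (hcov (2 * j + 1) d (hd (j + 1)) k hkA hi₁ hi₂)

/-- Halving K ∩ M n instead of K also gives L (n + 1) ⊆ M n, because a ∪ a = a. -/
theorem exists_isHalving {M : ℕ → Set (Set ℕ)} (hM : ∀ n, IsClosedHereditary (M n))
    (hMI : ∀ n, EventuallyContains (M n) I)
    (half : ∀ K, IsClosedHereditary K → EventuallyContains K I →
      ∃ K', IsClosedHereditary K' ∧ EventuallyContains K' I ∧
        ∀ a ∈ K', ∀ b ∈ K', a ∪ b ∈ K) :
    ∃ L : ℕ → Set (Set ℕ), L 0 = univ ∧ IsHalving L ∧ (∀ n, IsClosedHereditary (L n)) ∧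
      (∀ n, EventuallyContains (L n) I) ∧ ∀ n, L (n + 1) ⊆ M n := by
  let S := {K : Set (Set ℕ) // IsClosedHereditary K ∧ EventuallyContains K I}
  have step : ∀ (n : ℕ) (K : S), ∃ K' : S, ∀ a ∈ K'.1, ∀ b ∈ K'.1, a ∪ b ∈ K.1 ∩ M n := by
    rintro n ⟨K, hK, hKI⟩
    obtain ⟨K', h₁, h₂, h₃⟩ := half _ (hK.inter (hM n))
      (hKI.inter (hMI n) hK.isLowerSet (hM n).isLowerSet)
    exact ⟨⟨K', h₁, h₂⟩, h₃⟩
  choose g hg using step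
  let L : ℕ → S := fun n => Nat.rec
    ⟨univ, ⟨isLowerSet_univ, fun _ _ => trivial⟩, fun _ _ => ⟨0, trivial⟩⟩ g n
  have hL : ∀ n, ∀ a ∈ (L (n + 1)).1, ∀ b ∈ (L (n + 1)).1, a ∪ b ∈ (L n).1 ∩ M n :=
    fun n => hg n (L n)
  refine ⟨fun n => (L n).1, rfl, ⟨fun n => ?_, fun n a ha b hb => (hL n a ha b hb).1⟩,
    fun n => (L n).2.1, fun n => (L n).2.2, fun n a ha => ?_⟩
  · obtain ⟨k, hk⟩ := (L n).2.2 ∅ I.bot_mem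
    exact (L n).2.1.isLowerSet (empty_subset _) hk
  · simpa using (hL n a ha a ha).2

/-- **Solecki's theorem**: analytic P-ideals are given by finite lower semicontinuous
submeasures. -/
theorem IsAnalyticPIdeal.exists_submeasure (hI : IsAnalyticPIdeal I) :
    ∃ φ : Set ℕ → ℝ≥0∞,
      IsLSCSubmeasure φ ∧ φ univ < ∞ ∧ (I : Set (Set ℕ)) = exhFamily φ := by
  have hP := hI.pIdeal
  have hfin := hI.admissible.finite_mem
  have han := hI.analytic
  rw [IsAnalyticIdeal, MeasureTheory.AnalyticSet] at han
  obtain ⟨f, hf, hrange⟩ := han.resolve_left (Nonempty.ne_empty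
    ⟨fun _ => false, by simpa using hfin ∅ finite_empty⟩)
  set F : (ℕ → ℕ) → Set ℕ := fun a => {n | f a n = true}
  have hF : IsCantorContinuous F := hf.isCantorContinuous
  have hFI : ∀ a, F a ∈ I := fun a => by
    have : f a ∈ {c : ℕ → Bool | {n | c n = true} ∈ I} := hrange ▸ mem_range_self a
    exact this
  have huniv : Captures I F univ := by
    classical
    intro A hA
    obtain ⟨a, ha⟩ : (fun n => decide (n ∈ A)) ∈ range f := by
      rw [hrange]
      simpa using hA
    exact ⟨a, trivial, by simp [F, ha]⟩
  set C := captureCore I F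
  have hCne : C.Nonempty := by
    obtain ⟨a, ⟨-, ha⟩, -⟩ := huniv.inter_captureCore hP ∅ I.bot_mem
    exact ⟨a, ha⟩
  have hbasis := TopologicalSpace.isBasis_countableBasis (ℕ → ℕ)
  -- Only basic sets meeting C are enumerated, since these are the ones whose trace on C captures I.
  obtain ⟨b, hb⟩ := ((TopologicalSpace.countable_countableBasis (ℕ → ℕ)).mono
    (sep_subset _ fun U => (U ∩ C).Nonempty)).exists_eq_range (by
      obtain ⟨a, ha⟩ := hCne
      obtain ⟨U, hU, haU, -⟩ := hbasis.exists_subset_of_mem_open (mem_univ a) isOpen_univ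
      exact ⟨U, hU, a, haU, ha⟩)
  have hbmem : ∀ n, b n ∈ TopologicalSpace.countableBasis (ℕ → ℕ) ∧ (b n ∩ C).Nonempty :=
    fun n => by
      have : b n ∈ {U ∈ TopologicalSpace.countableBasis (ℕ → ℕ) | (U ∩ C).Nonempty} :=
        hb ▸ mem_range_self n
      exact this
  obtain ⟨L, hL₀, hL, hLcl, hLI, hLM⟩ := exists_isHalving
    (M := fun n => initialCover F (b n ∩ C))
    (fun n => isClosedHereditary_initialCover F _)
    (fun n => (captures_inter_captureCore hP (hbasis.isOpen (hbmem n).1)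
      (hbmem n).2).eventuallyContains)
    (fun K hK hKI => exists_isClosedHereditary_halving hP hF hFI huniv hK hKI)
  refine ⟨coverSubmeasure L, isLSCSubmeasure_coverSubmeasure fun n => (hLcl n).isLowerSet,
    ?_, ?_⟩
  -- As L 0 contains every set, the total mass is at most 2⁰ = 1.
  · refine (coverSubmeasure_le_of_mem (n := 0) (fun n => (hLcl n).isLowerSet)
      (hL₀ ▸ mem_univ _)).trans_lt ?_
    simp
  · ext A
    change A ∈ I ↔ exhNorm _ A = 0
    rw [hL.exhNorm_coverSubmeasure_eq_zero_iff hLcl]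
    refine ⟨fun hA i => hLI i A hA, fun hA => ?_⟩
    obtain ⟨c, d, n, hcd⟩ := exists_diff_subset_union hF hCne (A := A) (by
      rintro U hU ⟨a, haU, haC⟩
      obtain ⟨B, hB, haB, hBU⟩ := hbasis.exists_subset_of_mem_open haU hU
      obtain ⟨i, rfl⟩ : B ∈ range b := hb ▸ ⟨hB, a, haB, haC⟩
      obtain ⟨n, hn⟩ := hA (i + 1)
      exact ⟨n, initialCover_mono (inter_subset_inter_left _ hBU) (hLM i hn)⟩)
    refine Order.Ideal.mem_of_finite_diff hfin
      (Order.Ideal.sup_mem (hFI c) (hFI d)) ((finite_Iio n).subset ?_)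
    rintro k ⟨hkA, hk⟩
    by_contra hkn
    exact hk (hcd ⟨hkA, hkn⟩)

end Solecki

theorem theorem2p2 {X : Type*} [TopologicalSpace X] [FirstCountableTopology X]
    (x : ℕ → X) (I : Order.Ideal (Set ℕ)) (hI : IsAnalyticPIdeal I) :
    (∃ φ : Set ℕ → ℝ≥0∞,
      IsLSCSubmeasure φ ∧ φ univ < ∞ ∧ (I : Set (Set ℕ)) = exhFamily φ) ∧
    (∀ φ : Set ℕ → ℝ≥0∞, IsLSCSubmeasure φ → (I : Set (Set ℕ)) = exhFamily φ →
      ∃ u : X → ℝ≥0∞,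
        (∀ (ℓ : X) (U : ℕ → Set X), (𝓝 ℓ).HasAntitoneBasis U →
          Tendsto (fun k => exhNorm φ {n | x n ∈ U k}) atTop (𝓝 (u ℓ))) ∧
        UpperSemicontinuous u ∧
        idealLimitPoints I x = {ℓ | 0 < u ℓ}) ∧
    IsFSigma (idealLimitPoints I x) := by
  have hfin := hI.admissible.finite_mem
  have hex := hI.exists_submeasure
  refine ⟨hex, fun φ hφ hIφ => ⟨limitMass φ x, fun _ _ hU => hφ.tendsto_limitMass x hU,
    upperSemicontinuous_limitMass φ x, idealLimitPoints_eq x I hfin hφ hIφ⟩, ?_⟩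
  obtain ⟨φ, hφ, -, hIφ⟩ := hex
  rw [idealLimitPoints_eq x I hfin hφ hIφ]
  exact (upperSemicontinuous_limitMass φ x).isFSigma_pos
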